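/- For a partition $\lambda$ of a positive integer $n$, let the rank of $\lambda$ be its largest part minus its number of parts. Let $r$ be the number of parts of $\lambda$ equal to $1$; the crank of $\lambda$ is the largest part of $\lambda$ if $r=0$, and it is the number of parts of $\lambda$ that are larger than $r$, minus $r$, if $r>0$. Let $N(m,n)$ and $M(m,n)$ be the numbers of partitions of $n$ with rank $m$ and with crank $m$, respectively, let $p_n$ be the number of partitions of $n$, and define the rank and crank polynomials $$r_n(z)=\sum_{m=0}^{n-1}N(m,n)z^m,\qquad c_n(z)=\sum_{m=0}^{n}M(m,n)z^m .$$ Theorem. (i) For every $n\ge 1$, $r_n$ has non-negative coefficients, is monic of degree $n-1$, and satisfies $r_n(1)\le p_n$. For every $n\ge 2$, $c_n$ has non-negative coefficients, is monic of degree $n$, and satisfies $c_n(1)\le p_n$. For every $n\ge 3$, $r_n(0)\ne 0$ and $c_n(0)\neq 0$. (ii) The arguments of the zeros of the rank polynomials, and likewise those of the crank polynomials, are uniformly distributed on the unit circle as $n\to\infty$. That is, for $q_n=r_n$ and for $q_n=c_n$ the degrees tend to infinity, and the measures $$\frac{1}{\deg q_n}\sum_{z:\,q_n(z)=0}\delta_{z/|z|}$$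 on the unit circle (zeros counted with multiplicity) converge in the weak$^*$ topology, as $n\to\infty$, to normalized Lebesgue measure on the unit circle. -/

import Mathlib

open Polynomial MeasureTheory Filter Topology
open scoped NNReal ENNReal

/-- The largest part of a partition (`0` for the empty partition). -/
def Nat.Partition.largestPart {n : ℕ} (l : n.Partition) : ℕ := l.parts.sup

/-- Dyson's rank: the largest part minus the number of parts. -/
def Nat.Partition.rank {n : ℕ} (l : n.Partition) : ℤ :=
  (l.largestPart : ℤ) - (Multiset.card l.parts : ℤ)

/-- The number of parts equal to `1`. -/
def Nat.Partition.numOnes {n : ℕ} (l : n.Partition) : ℕ := l.parts.count 1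

/-- The Andrews–Garvan crank: the largest part if there is no part equal to `1`; otherwise, with
`r` the number of parts equal to `1`, the number of parts larger than `r` minus `r`. -/
def Nat.Partition.crank {n : ℕ} (l : n.Partition) : ℤ :=
  if l.numOnes = 0 then (l.largestPart : ℤ)
  else (Multiset.card (l.parts.filter (fun k => l.numOnes < k)) : ℤ) - (l.numOnes : ℤ)

/-- `p_n`, the number of partitions of `n`. -/
def partitionNumber (n : ℕ) : ℕ := Fintype.card n.Partition

/-- `N(m, n)`, the number of partitions of `n` with rank `m`. -/
def rankCount (m : ℤ) (n : ℕ) : ℕ :=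
  (Finset.univ.filter (fun l : n.Partition => l.rank = m)).card

/-- `M(m, n)`, the number of partitions of `n` with crank `m`. -/
def crankCount (m : ℤ) (n : ℕ) : ℕ :=
  (Finset.univ.filter (fun l : n.Partition => l.crank = m)).card

/-- The rank polynomial `r_n(z) = ∑_{m=0}^{n-1} N(m,n) z^m`. -/
noncomputable def rankPoly (n : ℕ) : ℤ[X] :=
  ∑ m ∈ Finset.range n, C (rankCount (m : ℤ) n : ℤ) * X ^ m

/-- The crank polynomial `c_n(z) = ∑_{m=0}^{n} M(m,n) z^m`. -/
noncomputable def crankPoly (n : ℕ) : ℤ[X] :=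
  ∑ m ∈ Finset.range (n + 1), C (crankCount (m : ℤ) n : ℤ) * X ^ m

/-- The unit circle carries its Borel σ-algebra. -/
noncomputable instance instMeasurableSpaceCircle : MeasurableSpace Circle := borel Circle

instance instBorelSpaceCircle : BorelSpace Circle := ⟨rfl⟩

/-- The argument of a nonzero complex number, as the point `exp(i arg z) = z / |z|` of the unit
circle. -/
noncomputable def argPoint (z : ℂ) : Circle := Circle.exp (Complex.arg z)

/-- The normalized counting measure `(1 / deg q) ∑ δ_{arg z}` on the unit circle, the sum running
over the zeros `z` of `q`, counted with multiplicity. -/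
noncomputable def zeroArgMeasure (q : ℂ[X]) : FiniteMeasure Circle :=
  (q.natDegree : ℝ≥0)⁻¹ •
    (q.roots.map (fun z => (diracProba (argPoint z)).toFiniteMeasure)).sum

/-- Normalized Lebesgue (arc length) measure on the unit circle: the image of `dθ / (2π)` on
`(-π, π]` under `θ ↦ exp(iθ)`. -/
noncomputable def circleLebesgue : FiniteMeasure Circle :=
  ⟨ENNReal.ofReal (1 / (2 * Real.pi)) •
      (volume.restrict (Set.Ioc (-Real.pi) Real.pi)).map Circle.exp,
    ⟨by
      rw [Measure.smul_apply, smul_eq_mul]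
      exact ENNReal.mul_lt_top ENNReal.ofReal_lt_top (measure_lt_top _ _)⟩⟩

/-- The arguments of the zeros of the polynomials `q_n`, whose degrees go to infinity, are uniformly
distributed on the unit circle as `n → ∞`: the normalized counting measures of the arguments
converge weakly to normalized Lebesgue measure. -/
def ZeroArgsUniformlyDistributed (q : ℕ → ℂ[X]) : Prop :=
  Tendsto (fun n => (q n).natDegree) atTop atTop ∧
    Tendsto (fun n => zeroArgMeasure (q n)) atTop (𝓝 circleLebesgue)

/-! The equidistribution is a qualitative Erdős–Turán argument. By Weyl's criterion
(`tendsto_finiteMeasure_circle_of_zpow`) it is enough that each nonzero power sum of the points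
z/|z| over the zeros is o(n). Let P be monic with |P(0)| ≥ 1 and |P| ≤ exp A on the unit circle.
Moving every zero radially to the circle keeps the product bounded by exp A there
(`norm_sub_argPoint_sq_mul_le`). The logarithm of ∏ (1 - a_i z) is then holomorphic in the disc with
real part at most A, so Borel–Carathéodory and Cauchy's estimates bound its Taylor coefficients,
which are the power sums up to a factor -1/k. Each power sum is thus O(A). For rank and crank
polynomials, non-negative coefficients give |P(z)| ≤ P(1) ≤ p_n on the circle, a nonzero integer
constant term gives |P(0)| ≥ 1, and p_n = exp(o(n)) (`eventually_partitionNumber_le_exp`) allows A =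
εn. -/

/-! ### Power sums of unimodular numbers -/

/-- The derivatives at points of the unit disc of a sum of principal logarithms `log (1 - a z)`. -/
theorem iteratedDeriv_sum_log_one_sub {ι : Type*} (s : Finset ι) (a : ι → ℂ)
    (ha : ∀ i ∈ s, ‖a i‖ = 1) (k : ℕ) : ∀ z : ℂ, ‖z‖ < 1 →
      iteratedDeriv (k + 1) (fun w => ∑ i ∈ s, Complex.log (1 - a i * w)) z =
        -(k.factorial : ℂ) * ∑ i ∈ s, a i ^ (k + 1) * ((1 - a i * z) ^ (k + 1))⁻¹ := by
  have hslit : ∀ z : ℂ, ‖z‖ < 1 → ∀ i ∈ s, 1 - a i * z ∈ Complex.slitPlane := by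
    intro z hz i hi
    rw [sub_eq_add_neg]
    apply Complex.mem_slitPlane_of_norm_lt_one
    simpa [ha i hi] using hz
  have hlin : ∀ (z : ℂ) (i : ι), HasDerivAt (fun w => 1 - a i * w) (-a i) z := by
    intro z i
    simpa using ((hasDerivAt_id z).const_mul (a i)).const_sub 1
  induction k with
  | zero =>
    intro z hz
    rw [zero_add, iteratedDeriv_one]
    have h : HasDerivAt (fun w => ∑ i ∈ s, Complex.log (1 - a i * w))
        (∑ i ∈ s, (-a i) / (1 - a i * z)) z :=
      HasDerivAt.fun_sum fun i hi => (hlin z i).clog (hslit z hz i hi)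
    rw [h.deriv, Finset.mul_sum]
    refine Finset.sum_congr rfl fun i _ => ?_
    simp [div_eq_mul_inv]
  | succ k ih =>
    intro z hz
    rw [iteratedDeriv_succ]
    have hev : iteratedDeriv (k + 1) (fun w => ∑ i ∈ s, Complex.log (1 - a i * w)) =ᶠ[𝓝 z]
        fun z => -(k.factorial : ℂ) * ∑ i ∈ s, a i ^ (k + 1) * ((1 - a i * z) ^ (k + 1))⁻¹ := by
      filter_upwards [(isOpen_lt continuous_norm continuous_const).mem_nhds hz] with w hw
      exact ih w hw
    rw [hev.deriv_eq]
    have h : HasDerivAt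
        (fun z => -(k.factorial : ℂ) * ∑ i ∈ s, a i ^ (k + 1) * ((1 - a i * z) ^ (k + 1))⁻¹)
        (-(k.factorial : ℂ) * ∑ i ∈ s, a i ^ (k + 1) *
          (-(((k + 1 : ℕ) : ℂ) * (1 - a i * z) ^ k * (-a i)) / ((1 - a i * z) ^ (k + 1)) ^ 2)) z := by
      refine HasDerivAt.const_mul _ (HasDerivAt.fun_sum fun i hi => HasDerivAt.const_mul _ ?_)
      exact ((hlin z i).pow (k + 1)).inv
        (pow_ne_zero _ (Complex.slitPlane_ne_zero (hslit z hz i hi)))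
    rw [h.deriv, Finset.mul_sum, Finset.mul_sum]
    refine Finset.sum_congr rfl fun i hi => ?_
    have h0 := Complex.slitPlane_ne_zero (hslit z hz i hi)
    rw [Nat.factorial_succ]
    push_cast
    field_simp
    ring

/-- If `∏ (1 - a_i z)` with unimodular `a_i` is bounded by `exp A` on the unit circle, then the
power sums of the `a_i` are bounded by `A` up to a constant depending only on the exponent. -/
theorem norm_sum_pow_le_of_norm_prod_le {ι : Type*} (s : Finset ι) (a : ι → ℂ)
    (ha : ∀ i ∈ s, ‖a i‖ = 1) {A : ℝ} (hA : 0 < A)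
    (hM : ∀ z : ℂ, ‖z‖ = 1 → ∏ i ∈ s, ‖1 - a i * z‖ ≤ Real.exp A) (k : ℕ) :
    ‖∑ i ∈ s, a i ^ (k + 1)‖ ≤ (k + 1) * (2 * A) * 2 ^ (k + 1) := by
  set f : ℂ → ℂ := fun w => ∑ i ∈ s, Complex.log (1 - a i * w) with hf
  have hslit : ∀ z : ℂ, ‖z‖ < 1 → ∀ i ∈ s, 1 - a i * z ∈ Complex.slitPlane := by
    intro z hz i hi
    rw [sub_eq_add_neg]
    apply Complex.mem_slitPlane_of_norm_lt_one
    simpa [ha i hi] using hz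
  have hd : DifferentiableOn ℂ f (Metric.ball 0 1) := by
    intro z hz
    have hz' : ‖z‖ < 1 := by simpa using hz
    apply DifferentiableAt.differentiableWithinAt
    refine DifferentiableAt.fun_sum fun i hi => ?_
    exact DifferentiableAt.clog (by fun_prop) (hslit z hz' i hi)
  have hprod : ∀ z : ℂ, ‖z‖ ≤ 1 → ‖∏ i ∈ s, (1 - a i * z)‖ ≤ Real.exp A := by
    intro z hz
    refine Complex.norm_le_of_forall_mem_frontier_norm_le (U := Metric.ball (0 : ℂ) 1)
      (f := fun z => ∏ i ∈ s, (1 - a i * z)) Metric.isBounded_ball ?_ ?_ ?_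
    · apply Differentiable.diffContOnCl
      fun_prop
    · intro w hw
      rw [frontier_ball _ one_ne_zero] at hw
      rw [norm_prod]
      exact hM w (by simpa using hw)
    · rw [closure_ball _ one_ne_zero]
      simpa using hz
  -- The sum of principal logarithms is a holomorphic logarithm of the product, so the maximum
  -- principle bound `hprod` becomes a bound on its real part.
  have hre : Set.MapsTo f (Metric.ball 0 1) {z | z.re ≤ A} := by
    intro z hz
    have hz' : ‖z‖ < 1 := by simpa using hz
    have h1 : Complex.exp (f z) = ∏ i ∈ s, (1 - a i * z) := by
      rw [hf, Complex.exp_sum]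
      exact Finset.prod_congr rfl fun i hi =>
        Complex.exp_log (Complex.slitPlane_ne_zero (hslit z hz' i hi))
    have h2 := hprod z hz'.le
    rw [← h1, Complex.norm_exp] at h2
    exact Real.exp_le_exp.1 h2
  have hbound : ∀ z ∈ Metric.sphere (0 : ℂ) (1 / 2), ‖f z‖ ≤ 2 * A := by
    intro z hz
    have hz' : ‖z‖ = 1 / 2 := by simpa using hz
    have h := Complex.borelCaratheodory_zero hA hd hre one_pos (z := z)
      (by simp only [Metric.mem_ball, dist_zero_right]; linarith) (by simp [hf])
    rw [hz'] at h
    norm_num at h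
    linarith
  -- Cauchy's estimate at radius 1/2 gives (k+1)! · 2A · 2^(k+1). The derivative at 0 is -k! times
  -- the power sum, which leaves the factor k+1.
  have hc := Complex.norm_iteratedDeriv_le_of_forall_mem_sphere_norm_le (k + 1)
    (by norm_num : (0 : ℝ) < 1 / 2)
    ((hd.mono (Metric.closedBall_subset_ball (by norm_num))).diffContOnCl_ball subset_rfl) hbound
  rw [hf, iteratedDeriv_sum_log_one_sub s a ha k 0 (by simp)] at hc
  simp only [mul_zero, sub_zero, one_pow, inv_one, mul_one, norm_mul, norm_neg,
    Complex.norm_natCast, Nat.factorial_succ] at hc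
  have hk : (0 : ℝ) < k.factorial := by positivity
  refine le_of_mul_le_mul_left (hc.trans_eq ?_) hk
  rw [one_div, inv_pow, div_inv_eq_mul]
  push_cast
  ring

/-! ### Moving the zeros to the unit circle -/

theorem coe_argPoint (w : ℂ) : (argPoint w : ℂ) = Complex.exp (Complex.arg w * Complex.I) := by
  simp [argPoint]

/-- Writing w = ru with |u| = 1, the right side minus the left is exactly (r - 1)². -/
theorem norm_sub_argPoint_sq_mul_le (w z : ℂ) (hz : ‖z‖ = 1) :
    ‖z - argPoint w‖ ^ 2 * ‖w‖ ≤ ‖z - w‖ ^ 2 := by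
  have hw : w = (‖w‖ : ℂ) * argPoint w := by
    rw [coe_argPoint, Complex.norm_mul_exp_arg_mul_I]
  have hu : ‖(argPoint w : ℂ)‖ = 1 := Circle.norm_coe _
  generalize (argPoint w : ℂ) = u at *
  generalize ‖w‖ = r at *
  have hz2 : z.re * z.re + z.im * z.im = 1 := by
    rw [← Complex.normSq_apply, Complex.normSq_eq_norm_sq, hz, one_pow]
  have hu2 : u.re * u.re + u.im * u.im = 1 := by
    rw [← Complex.normSq_apply, Complex.normSq_eq_norm_sq, hu, one_pow]
  subst hw
  rw [← Complex.normSq_eq_norm_sq, ← Complex.normSq_eq_norm_sq, Complex.normSq_apply,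
    Complex.normSq_apply]
  simp only [Complex.sub_re, Complex.sub_im, Complex.re_ofReal_mul, Complex.im_ofReal_mul]
  have h := sq_nonneg (r - 1)
  have e : (z.re - r * u.re) * (z.re - r * u.re) + (z.im - r * u.im) * (z.im - r * u.im) -
      ((z.re - u.re) * (z.re - u.re) + (z.im - u.im) * (z.im - u.im)) * r = (r - 1) ^ 2 := by
    linear_combination (1 - r) * hz2 + (r ^ 2 - r) * hu2
  linarith

/-- Power sums of the arguments of the zeros of a monic polynomial that is bounded on the unit
circle and not too small at the origin. -/
theorem Polynomial.norm_sum_argPoint_pow_le {P : ℂ[X]} (hP : P.Monic) (h0 : 1 ≤ ‖P.eval 0‖) {A : ℝ}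
    (hA : 0 < A) (hM : ∀ z : ℂ, ‖z‖ = 1 → ‖P.eval z‖ ≤ Real.exp A) (k : ℕ) :
    ‖(P.roots.map fun w => (argPoint w : ℂ) ^ (k + 1)).sum‖ ≤
      (k + 1) * (2 * A) * 2 ^ (k + 1) := by
  have heval : ∀ z : ℂ, ‖P.eval z‖ = ∏ w : P.roots, ‖z - w.1‖ := by
    intro z
    have hs := (IsAlgClosed.splits P).eval_eq_prod_roots_of_monic hP z
    rw [hs, ← norm_prod]
    congr 1
    rw [← Multiset.map_univ_coe P.roots]
    simp [Finset.prod]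
  have hsum : (P.roots.map fun w => (argPoint w : ℂ) ^ (k + 1)).sum =
      ∑ w : P.roots, (argPoint w.1 : ℂ) ^ (k + 1) := by
    rw [← Multiset.map_univ (m := P.roots)]
    rfl
  rw [hsum]
  refine norm_sum_pow_le_of_norm_prod_le Finset.univ (fun w : P.roots => (argPoint w.1 : ℂ))
    (fun _ _ => Circle.norm_coe _) hA (fun z hz => ?_) k
  -- Since 1 - uz = z(z⁻¹ - u), evaluating P at z⁻¹ gives the power sums of the points u themselves,
  -- not of their conjugates.
  have hz' : ‖z⁻¹‖ = 1 := by rw [norm_inv, hz, inv_one]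
  have hz0 : z ≠ 0 := by rintro rfl; simp at hz
  have h1 : ∀ w : P.roots, ‖1 - (argPoint w.1 : ℂ) * z‖ = ‖z⁻¹ - argPoint w.1‖ := by
    intro w
    have : 1 - (argPoint w.1 : ℂ) * z = (z⁻¹ - argPoint w.1) * z := by field_simp
    rw [this, norm_mul, hz, mul_one]
  simp only [h1]
  -- The factors |w| multiply to |P(0)|.
  have h2 : (∏ w : P.roots, ‖z⁻¹ - argPoint w.1‖) ^ 2 * ‖P.eval 0‖ ≤ ‖P.eval z⁻¹‖ ^ 2 := by
    rw [heval, heval, ← Finset.prod_pow, ← Finset.prod_pow, ← Finset.prod_mul_distrib]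
    refine Finset.prod_le_prod (fun _ _ => by positivity) fun w _ => ?_
    simpa using norm_sub_argPoint_sq_mul_le w.1 z⁻¹ hz'
  refine le_trans ?_ (hM z⁻¹ hz')
  refine le_of_sq_le_sq ?_ (norm_nonneg _)
  exact le_trans (le_mul_of_one_le_right (sq_nonneg _) h0) h2

/-! ### Weak convergence on the circle -/

/-- **Weyl's criterion** for weak convergence of finite measures on the unit circle. -/
theorem tendsto_finiteMeasure_circle_of_zpow {F : Filter ℕ} {μs : ℕ → FiniteMeasure Circle}
    {μ : FiniteMeasure Circle} (hmass : ∀ n, (μs n).mass ≤ 1) (hμ : μ.mass ≤ 1)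
    (h : ∀ k : ℤ, Tendsto (fun n => ∫ z : Circle, ((z ^ k : Circle) : ℂ) ∂(μs n : Measure Circle)) F
      (𝓝 (∫ z : Circle, ((z ^ k : Circle) : ℂ) ∂(μ : Measure Circle)))) :
    Tendsto μs F (𝓝 μ) := by
  rw [FiniteMeasure.tendsto_iff_forall_integral_rclike_tendsto ℂ]
  have hint : ∀ (g : C(Circle, ℂ)) (ν : FiniteMeasure Circle), Integrable g (ν : Measure Circle) :=
    fun g ν => (BoundedContinuousFunction.mkOfCompact g).integrable _
  have : Fact (0 < (1 : ℝ)) := ⟨one_pos⟩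
  let e : UnitAddCircle ≃ₜ Circle := AddCircle.homeomorphCircle one_ne_zero
  let pull : C(UnitAddCircle, ℂ) → C(Circle, ℂ) := fun g => g.comp ⟨e.symm, e.symm.continuous⟩
  -- The test functions whose integrals converge form a subspace. It contains the characters, and
  -- the mass bounds make it closed under uniform limits, so it is everything.
  let S : Submodule ℂ C(UnitAddCircle, ℂ) :=
    { carrier := {g | Tendsto (fun n => ∫ z, pull g z ∂(μs n : Measure Circle)) F
        (𝓝 (∫ z, pull g z ∂(μ : Measure Circle)))}
      zero_mem' := by
        have hzero : ∀ z, pull 0 z = 0 := fun _ => rfl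
        simp only [Set.mem_ofPred_eq, hzero, integral_zero]
        exact tendsto_const_nhds
      add_mem' := by
        intro g₁ g₂ h₁ h₂
        have hadd : ∀ ν : FiniteMeasure Circle, ∫ z, pull (g₁ + g₂) z ∂(ν : Measure Circle) =
            ∫ z, pull g₁ z ∂(ν : Measure Circle) + ∫ z, pull g₂ z ∂(ν : Measure Circle) :=
          fun ν => integral_add (hint (pull g₁) ν) (hint (pull g₂) ν)
        simp only [Set.mem_ofPred_eq, hadd] at h₁ h₂ ⊢
        exact h₁.add h₂
      smul_mem' := by
        intro c g hg
        have hsmul : ∀ ν : FiniteMeasure Circle, ∫ z, pull (c • g) z ∂(ν : Measure Circle) =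
            c • ∫ z, pull g z ∂(ν : Measure Circle) :=
          fun ν => integral_smul c (pull g)
        simp only [Set.mem_ofPred_eq, hsmul] at hg ⊢
        exact hg.const_smul c }
  have hfourier : Submodule.span ℂ (Set.range (@fourier 1)) ≤ S := by
    rw [Submodule.span_le]
    rintro _ ⟨k, rfl⟩
    have hk : ∀ z : Circle, pull (fourier k) z = ((z ^ k : Circle) : ℂ) := by
      intro z
      obtain ⟨x, rfl⟩ := e.surjective z
      have hpull : pull (fourier k) (e x) = fourier k x := by
        change fourier k (e.symm (e x)) = _
        rw [e.symm_apply_apply]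
      rw [hpull, fourier_apply, AddCircle.toCircle_zsmul, AddCircle.homeomorphCircle_apply]
    change Tendsto _ _ _
    simp only [hk]
    exact h k
  have hdense : ∀ g : C(UnitAddCircle, ℂ), g ∈ S := by
    intro g
    have hg : g ∈ (Submodule.span ℂ (Set.range (@fourier 1))).topologicalClosure := by
      rw [span_fourier_closure_eq_top]
      trivial
    change Tendsto _ _ _
    rw [Metric.tendsto_nhds]
    intro ε hε
    obtain ⟨g', hg', hd⟩ := Metric.mem_closure_iff.1 hg (ε / 4) (by positivity)
    have hd' : ∀ ν : FiniteMeasure Circle, ν.mass ≤ 1 →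
        dist (∫ z, pull g z ∂(ν : Measure Circle)) (∫ z, pull g' z ∂(ν : Measure Circle)) ≤
          ε / 4 := by
      intro ν hν
      rw [dist_eq_norm, ← integral_sub (hint _ ν) (hint _ ν)]
      have hb : ∀ z, ‖pull g z - pull g' z‖ ≤ ε / 4 := by
        intro z
        rw [← dist_eq_norm]
        exact (ContinuousMap.dist_apply_le_dist (f := g) (g := g') (e.symm z)).trans hd.le
      refine (norm_integral_le_of_norm_le_const (Eventually.of_forall hb)).trans ?_
      have : (ν : Measure Circle).real Set.univ ≤ 1 := by
        rw [FiniteMeasure.measureReal_eq_coe_coeFn]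
        exact_mod_cast hν
      exact mul_le_of_le_one_right (by positivity) this
    have hconv : Tendsto (fun n => ∫ z, pull g' z ∂(μs n : Measure Circle)) F
        (𝓝 (∫ z, pull g' z ∂(μ : Measure Circle))) := hfourier hg'
    filter_upwards [Metric.tendsto_nhds.1 hconv (ε / 4) (by positivity)] with n hn
    have h1 := hd' (μs n) (hmass n)
    have h2 := hd' μ hμ
    rw [dist_comm] at h2
    have h3 := dist_triangle4 (∫ z, pull g z ∂(μs n : Measure Circle))
      (∫ z, pull g' z ∂(μs n : Measure Circle)) (∫ z, pull g' z ∂(μ : Measure Circle))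
      (∫ z, pull g z ∂(μ : Measure Circle))
    linarith
  intro f
  have hf := hdense (f.toContinuousMap.comp ⟨e, e.continuous⟩)
  have hpull : ∀ z, pull (f.toContinuousMap.comp ⟨e, e.continuous⟩) z = f z := by
    intro z
    simp [pull]
  change Tendsto _ _ _ at hf
  simpa only [hpull] using hf

theorem circleLebesgue_mass : circleLebesgue.mass = 1 := by
  rw [← ENNReal.coe_inj, FiniteMeasure.ennreal_mass]
  simp only [circleLebesgue, FiniteMeasure.toMeasure_mk, Measure.smul_apply, smul_eq_mul]
  rw [Measure.map_apply Circle.exp.continuous.measurable MeasurableSet.univ]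
  simp only [Set.preimage_univ, Measure.restrict_apply MeasurableSet.univ, Set.univ_inter,
    Real.volume_Ioc, ENNReal.coe_one]
  rw [← ENNReal.ofReal_mul (by positivity), ← ENNReal.ofReal_one]
  congr 1
  field_simp
  ring

theorem integral_zpow_circleLebesgue {k : ℤ} (hk : k ≠ 0) :
    ∫ z : Circle, ((z ^ k : Circle) : ℂ) ∂(circleLebesgue : Measure Circle) = 0 := by
  simp only [circleLebesgue, FiniteMeasure.toMeasure_mk]
  have hcont : Continuous fun z : Circle => ((z ^ k : Circle) : ℂ) :=
    Continuous.comp (by fun_prop : Continuous fun z : Circle => (z : ℂ))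
      (continuous_zpow (G := Circle) k)
  rw [integral_smul_measure, integral_map Circle.exp.continuous.aemeasurable
    hcont.aestronglyMeasurable, ← intervalIntegral.integral_of_le (by linarith [Real.pi_pos])]
  have hc : (k : ℂ) * Complex.I ≠ 0 := by simp [hk]
  have h : ∀ x : ℝ, ((Circle.exp x ^ k : Circle) : ℂ) = Complex.exp ((k : ℂ) * Complex.I * x) := by
    intro x
    rw [Circle.coe_zpow, Circle.coe_exp, ← Complex.exp_int_mul]
    ring_nf
  simp only [h]
  rw [integral_exp_mul_complex hc]
  have : Complex.exp ((k : ℂ) * Complex.I * (Real.pi : ℝ)) =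
      Complex.exp ((k : ℂ) * Complex.I * (-Real.pi : ℝ)) := by
    rw [Complex.exp_eq_exp_iff_exists_int]
    exact ⟨k, by push_cast; ring⟩
  rw [this]
  simp

theorem integral_sum_diracProba (m : Multiset ℂ) (g : C(Circle, ℂ)) :
    ∫ z, g z ∂(((m.map fun w => (diracProba (argPoint w)).toFiniteMeasure).sum :
      FiniteMeasure Circle) : Measure Circle) = (m.map fun w => g (argPoint w)).sum := by
  have hint : ∀ ν : FiniteMeasure Circle, Integrable g (ν : Measure Circle) :=
    fun ν => (BoundedContinuousFunction.mkOfCompact g).integrable _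
  induction m using Multiset.induction_on with
  | empty => simp
  | cons w m ih =>
    rw [Multiset.map_cons, Multiset.sum_cons, FiniteMeasure.toMeasure_add,
      integral_add_measure (hint _) (hint _), ih, Multiset.map_cons, Multiset.sum_cons]
    congr 1
    exact integral_dirac _ _

theorem integral_zeroArgMeasure (q : ℂ[X]) (g : C(Circle, ℂ)) :
    ∫ z, g z ∂(zeroArgMeasure q : Measure Circle) =
      (q.natDegree : ℂ)⁻¹ * (q.roots.map fun w => g (argPoint w)).sum := by
  rw [zeroArgMeasure, FiniteMeasure.toMeasure_smul, integral_smul_nnreal_measure,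
    integral_sum_diracProba]
  simp [NNReal.smul_def]

/-- The unsimplified product covers degree 0, where it vanishes; hence the mass is at most 1 for
every polynomial. -/
theorem zeroArgMeasure_mass (q : ℂ[X]) :
    (zeroArgMeasure q).mass = (q.natDegree : ℝ≥0)⁻¹ * q.natDegree := by
  have hsum : ∀ m : Multiset ℂ,
      (m.map fun w => (diracProba (argPoint w)).toFiniteMeasure).sum.mass = m.card := by
    intro m
    induction m using Multiset.induction_on with
    | empty => simp
    | cons w m ih =>
      rw [Multiset.map_cons, Multiset.sum_cons, FiniteMeasure.mass, FiniteMeasure.coeFn_add,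
        Pi.add_apply, ← FiniteMeasure.mass, ← FiniteMeasure.mass, ih]
      simp [add_comm]
  rw [zeroArgMeasure, FiniteMeasure.mass, FiniteMeasure.coeFn_smul, Pi.smul_apply,
    ← FiniteMeasure.mass, hsum, IsAlgClosed.card_roots_eq_natDegree]
  simp

/-! ### Growth of the partition numbers -/

theorem Nat.Partition.sum_count_mul {n : ℕ} (l : n.Partition) :
    ∑ i : Fin n, l.parts.count (i + 1 : ℕ) * (i + 1 : ℕ) = n := by
  have h := Finset.sum_multiset_count_of_subset l.parts (Finset.range (n + 1)) fun a ha => by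
    rw [Multiset.mem_toFinset] at ha
    exact Finset.mem_range_succ_iff.2 (l.le_of_mem_parts ha)
  rw [l.parts_sum, Finset.sum_range_succ'] at h
  rw [Fin.sum_univ_eq_sum_range (fun i => l.parts.count (i + 1) * (i + 1)) n]
  simpa using h.symm

theorem Nat.Partition.count_injective (n : ℕ) :
    Function.Injective fun (l : n.Partition) (i : Fin n) => l.parts.count (i + 1 : ℕ) := by
  intro l l' h
  apply Nat.Partition.ext
  rw [Multiset.ext]
  intro a
  by_cases ha : 0 < a ∧ a ≤ n
  · have := congrFun h ⟨a - 1, by omega⟩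
    simpa [Nat.sub_add_cancel ha.1] using this
  · have hz : ∀ l : n.Partition, l.parts.count a = 0 := fun l =>
      Multiset.count_eq_zero.2 fun hm => ha ⟨l.parts_pos hm, l.le_of_mem_parts hm⟩
    rw [hz, hz]

theorem Nat.Partition.count_le {n : ℕ} (l : n.Partition) (i : Fin n) :
    l.parts.count (i + 1 : ℕ) ≤ n := by
  calc l.parts.count (i + 1 : ℕ) ≤ l.parts.count (i + 1 : ℕ) * (i + 1 : ℕ) :=
        Nat.le_mul_of_pos_right _ (Nat.succ_pos _)
    _ ≤ ∑ i : Fin n, l.parts.count (i + 1 : ℕ) * (i + 1 : ℕ) :=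
        Finset.single_le_sum (f := fun i : Fin n => l.parts.count (i + 1 : ℕ) * (i + 1 : ℕ))
          (fun _ _ => Nat.zero_le _) (Finset.mem_univ i)
    _ = n := l.sum_count_mul

/-- The coefficient bound for the generating function of the partition numbers. -/
theorem partitionNumber_mul_pow_le (n : ℕ) {x : ℝ} (h0 : 0 ≤ x) (h1 : x < 1) :
    partitionNumber n * x ^ n ≤ ∏ i : Fin n, (1 - x ^ (i + 1 : ℕ))⁻¹ := by
  have hgeom : ∀ i : Fin n, ∑ j ∈ Finset.range (n + 1), (x ^ (i + 1 : ℕ)) ^ j ≤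
      (1 - x ^ (i + 1 : ℕ))⁻¹ := by
    intro i
    have hlt : x ^ (i + 1 : ℕ) < 1 := pow_lt_one₀ h0 h1 (Nat.succ_ne_zero _)
    rw [← tsum_geometric_of_lt_one (by positivity) hlt]
    exact (summable_geometric_of_lt_one (by positivity) hlt).sum_le_tsum _
      fun _ _ => by positivity
  refine le_trans ?_ (Finset.prod_le_prod (fun _ _ => by positivity) fun i _ => hgeom i)
  rw [Finset.prod_univ_sum]
  -- In the expanded product, each partition of n picks out, through its multiplicities, its own
  -- monomial, equal to x^n.
  have himg : (Finset.univ.image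
      fun (l : n.Partition) (i : Fin n) => l.parts.count (i + 1 : ℕ)) ⊆
      Fintype.piFinset fun _ : Fin n => Finset.range (n + 1) := by
    intro c hc
    obtain ⟨l, -, rfl⟩ := Finset.mem_image.1 hc
    exact Fintype.mem_piFinset.2 fun i => Finset.mem_range_succ_iff.2 (l.count_le i)
  refine le_trans ?_ (Finset.sum_le_sum_of_subset_of_nonneg himg fun _ _ _ => by positivity)
  rw [Finset.sum_image fun _ _ _ _ h => Nat.Partition.count_injective n h]
  have hterm : ∀ l : n.Partition,
      ∏ i : Fin n, (x ^ (i + 1 : ℕ)) ^ l.parts.count (i + 1 : ℕ) = x ^ n := by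
    intro l
    simp_rw [← pow_mul]
    rw [Finset.prod_pow_eq_pow_sum]
    congr 1
    refine Eq.trans ?_ l.sum_count_mul
    exact Finset.sum_congr rfl fun _ _ => mul_comm _ _
  simp only [hterm, Finset.sum_const, nsmul_eq_mul, partitionNumber, Fintype.card, le_refl]

/-- With y = x^(i+1), 1/(1-y) = 1 + y/(1-y) ≤ exp(x^i/(1-x)), and the exponents sum geometrically.
The bound does not depend on n. -/
theorem partitionNumber_mul_pow_le_exp (n : ℕ) {x : ℝ} (h0 : 0 ≤ x) (h1 : x < 1) :
    partitionNumber n * x ^ n ≤ Real.exp ((1 - x)⁻¹ * (1 - x)⁻¹) := by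
  refine (partitionNumber_mul_pow_le n h0 h1).trans ?_
  have hx : 0 < 1 - x := sub_pos.2 h1
  have hfac : ∀ i : Fin n, (1 - x ^ (i + 1 : ℕ))⁻¹ ≤ Real.exp (x ^ (i : ℕ) * (1 - x)⁻¹) := by
    intro i
    have hlt : x ^ (i + 1 : ℕ) < 1 := pow_lt_one₀ h0 h1 (Nat.succ_ne_zero _)
    have hle : x ^ (i + 1 : ℕ) ≤ x := pow_le_of_le_one h0 h1.le (Nat.succ_ne_zero _)
    have hle' : x ^ (i + 1 : ℕ) ≤ x ^ (i : ℕ) := pow_le_pow_of_le_one h0 h1.le (Nat.le_succ _)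
    have hpos : 0 < 1 - x ^ (i + 1 : ℕ) := sub_pos.2 hlt
    have he : (1 - x ^ (i + 1 : ℕ))⁻¹ =
        x ^ (i + 1 : ℕ) * (1 - x ^ (i + 1 : ℕ))⁻¹ + 1 := by
      field_simp
      ring
    rw [he]
    refine (Real.add_one_le_exp _).trans (Real.exp_le_exp.2 ?_)
    gcongr
  refine (Finset.prod_le_prod (fun i _ => ?_) fun i _ => hfac i).trans ?_
  · exact inv_nonneg.2 (sub_nonneg.2 (pow_le_one₀ h0 h1.le))
  · rw [← Real.exp_sum, Real.exp_le_exp, ← Finset.sum_mul]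
    gcongr
    rw [Fin.sum_univ_eq_sum_range (fun i => x ^ i) n, ← tsum_geometric_of_lt_one h0 h1]
    exact (summable_geometric_of_lt_one h0 h1).sum_le_tsum _ fun _ _ => by positivity

/-- The partition numbers grow subexponentially. -/
theorem eventually_partitionNumber_le_exp {ε : ℝ} (hε : 0 < ε) :
    ∀ᶠ n : ℕ in atTop, (partitionNumber n : ℝ) ≤ Real.exp (ε * n) := by
  -- This x costs exp(εn/2); the other half of ε absorbs the constant K.
  set x := Real.exp (-(ε / 2)) with hx
  have h1 : x < 1 := Real.exp_lt_one_iff.2 (by linarith)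
  set K := (1 - x)⁻¹ * (1 - x)⁻¹
  have hlim : Tendsto (fun n : ℕ => ε / 2 * (n : ℝ)) atTop atTop :=
    tendsto_natCast_atTop_atTop.const_mul_atTop (by positivity)
  filter_upwards [hlim.eventually_ge_atTop K] with n hn
  have h : partitionNumber n * x ^ n ≤ Real.exp K :=
    partitionNumber_mul_pow_le_exp n (Real.exp_pos _).le h1
  rw [hx, ← Real.exp_nat_mul] at h
  have h' : (partitionNumber n : ℝ) ≤ Real.exp K * Real.exp (ε / 2 * n) := by
    rw [← div_le_iff₀ (Real.exp_pos _), div_eq_mul_inv, ← Real.exp_neg,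
      show -(ε / 2 * n) = n * -(ε / 2) by ring]
    exact h
  refine h'.trans ?_
  rw [← Real.exp_add, Real.exp_le_exp]
  linarith

/-! ### Coefficients of the rank and crank polynomials -/

theorem coeff_sum_range_C_mul_X_pow {R : Type*} [Semiring R] (c : ℕ → R) (K k : ℕ) :
    (∑ m ∈ Finset.range K, C (c m) * X ^ m).coeff k = if k < K then c k else 0 := by
  simp [coeff_X_pow]

theorem monic_and_natDegree_sum_range_C_mul_X_pow {R : Type*} [Semiring R] [Nontrivial R]
    (c : ℕ → R) (K : ℕ) (h : c K = 1) :
    (∑ m ∈ Finset.range (K + 1), C (c m) * X ^ m).Monic ∧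
      (∑ m ∈ Finset.range (K + 1), C (c m) * X ^ m).natDegree = K := by
  have hc : (∑ m ∈ Finset.range (K + 1), C (c m) * X ^ m).coeff K = 1 := by
    rw [coeff_sum_range_C_mul_X_pow, if_pos (Nat.lt_succ_self K), h]
  have hd : (∑ m ∈ Finset.range (K + 1), C (c m) * X ^ m).natDegree ≤ K :=
    natDegree_sum_le_of_forall_le _ _ fun m hm =>
      (natDegree_C_mul_X_pow_le _ _).trans (Finset.mem_range_succ_iff.1 hm)
  exact ⟨monic_of_natDegree_le_of_coeff_eq_one K hd hc,
    natDegree_eq_of_le_of_coeff_ne_zero hd (by simp [hc])⟩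

theorem sum_range_card_fiber_le {α : Type*} [Fintype α] (f : α → ℤ) (K : ℕ) :
    ∑ m ∈ Finset.range K, (Finset.univ.filter fun a => f a = (m : ℤ)).card ≤ Fintype.card α := by
  classical
  rw [← Finset.card_biUnion]
  · exact Finset.card_le_univ _
  · intro i _ j _ hij
    rw [Function.onFun, Finset.disjoint_left]
    intro a ha hb
    simp only [Finset.mem_filter] at ha hb
    exact hij (by exact_mod_cast ha.2.symm.trans hb.2)

namespace Nat.Partition

theorem largestPart_le {n : ℕ} (l : n.Partition) : l.largestPart ≤ n :=
  Multiset.sup_le.2 fun _ h => l.le_of_mem_parts h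

theorem card_parts_pos {n : ℕ} (hn : n ≠ 0) (l : n.Partition) : 0 < l.parts.card := by
  rw [Multiset.card_pos]
  intro h
  exact hn (by rw [← l.parts_sum, h, Multiset.sum_zero])

theorem card_parts_le {n : ℕ} (l : n.Partition) : l.parts.card ≤ n := by
  have h := Multiset.card_nsmul_le_sum (s := l.parts) (a := 1) fun _ h => l.parts_pos h
  simpa [l.parts_sum] using h

theorem eq_indiscrete_of_card_parts_eq_one {n : ℕ} (hn : n ≠ 0) (l : n.Partition)
    (h : l.parts.card = 1) : l = indiscrete n := by
  obtain ⟨a, ha⟩ := Multiset.card_eq_one.1 h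
  have hs := l.parts_sum
  rw [ha, Multiset.sum_singleton] at hs
  apply Nat.Partition.ext
  rw [indiscrete_parts hn, ha, hs]

theorem eq_indiscrete_of_mem_parts {n : ℕ} (hn : n ≠ 0) (l : n.Partition)
    (h : n ∈ l.parts) : l = indiscrete n := by
  obtain ⟨t, ht⟩ := Multiset.exists_cons_of_mem h
  have hs := l.parts_sum
  rw [ht, Multiset.sum_cons] at hs
  have ht0 : t = 0 := by
    refine Multiset.eq_zero_of_forall_notMem fun a ha => ?_
    have h1 := Multiset.le_sum_of_mem ha
    have h2 := l.parts_pos (i := a) (by rw [ht]; exact Multiset.mem_cons_of_mem ha)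
    omega
  apply eq_indiscrete_of_card_parts_eq_one hn
  rw [ht, ht0]
  rfl

theorem largestPart_indiscrete {n : ℕ} (hn : n ≠ 0) : (indiscrete n).largestPart = n := by
  simp [largestPart, indiscrete_parts hn]

/-- The largest part is at most n and there is at least one part, so rank n - 1 forces a single
part. This makes the leading coefficient 1. -/
theorem rank_eq_pred_iff {n : ℕ} (hn : n ≠ 0) (l : n.Partition) :
    l.rank = ((n - 1 : ℕ) : ℤ) ↔ l = indiscrete n := by
  constructor
  · intro h
    apply eq_indiscrete_of_card_parts_eq_one hn
    have h1 := l.largestPart_le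
    have h2 := l.card_parts_pos hn
    rw [rank] at h
    omega
  · rintro rfl
    rw [rank, largestPart_indiscrete hn, indiscrete_parts hn, Multiset.card_singleton]
    omega

theorem largestPart_mem {n : ℕ} (hn : n ≠ 0) (l : n.Partition) : l.largestPart ∈ l.parts := by
  obtain ⟨b, hb, hmax⟩ := Multiset.exists_max_image id
    (Multiset.card_pos.1 (l.card_parts_pos hn))
  have : l.largestPart = b := le_antisymm (Multiset.sup_le.2 hmax) (Multiset.le_sup hb)
  rwa [this]

/-- If some part is 1, the crank is at most n - 1, so crank n requires the largest part to be n. For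
n = 1 the only partition has crank -1. -/
theorem crank_eq_self_iff {n : ℕ} (hn : 2 ≤ n) (l : n.Partition) :
    l.crank = (n : ℤ) ↔ l = indiscrete n := by
  have hn0 : n ≠ 0 := by omega
  constructor
  · intro h
    rw [crank] at h
    split_ifs at h with h0
    · apply eq_indiscrete_of_mem_parts hn0
      have hm := l.largestPart_mem hn0
      rwa [Int.natCast_inj.1 h] at hm
    · have h1 := Multiset.card_le_card (Multiset.filter_le (fun k => l.numOnes < k) l.parts)
      have h2 := l.card_parts_le
      omega
  · rintro rfl
    have h0 : (indiscrete n).numOnes = 0 := by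
      rw [numOnes, indiscrete_parts hn0, Multiset.count_eq_zero, Multiset.mem_singleton]
      omega
    rw [crank, if_pos h0, largestPart_indiscrete hn0]

/-- Witnesses: (k, 2, 1^(k-2)) for n = 2k, and (k+1, 1^k) for n = 2k+1. -/
theorem exists_rank_eq_zero {n : ℕ} (hn : 3 ≤ n) : ∃ l : n.Partition, l.rank = 0 := by
  rcases Nat.even_or_odd' n with ⟨k, rfl | rfl⟩
  · refine ⟨⟨k ::ₘ 2 ::ₘ Multiset.replicate (k - 2) 1, ?_, ?_⟩, ?_⟩
    · intro i hi
      simp only [Multiset.mem_cons, Multiset.mem_replicate] at hi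
      omega
    · simp
      omega
    · have hs : (Multiset.replicate (k - 2) 1).sup ≤ 1 :=
        Multiset.sup_le.2 fun a ha => (Multiset.eq_of_mem_replicate ha).le
      simp only [rank, largestPart, Multiset.sup_cons, Multiset.card_cons,
        Multiset.card_replicate]
      have : max k (max 2 (Multiset.replicate (k - 2) 1).sup) = k := by omega
      rw [this]
      omega
  · refine ⟨⟨(k + 1) ::ₘ Multiset.replicate k 1, ?_, ?_⟩, ?_⟩
    · intro i hi
      simp only [Multiset.mem_cons, Multiset.mem_replicate] at hi
      omega
    · simp
      omega
    · have hs : (Multiset.replicate k 1).sup ≤ 1 :=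
        Multiset.sup_le.2 fun a ha => (Multiset.eq_of_mem_replicate ha).le
      simp only [rank, largestPart, Multiset.sup_cons, Multiset.card_cons,
        Multiset.card_replicate]
      have : max (k + 1) (Multiset.replicate k 1).sup = k + 1 := by omega
      rw [this]
      omega

theorem exists_crank_eq_zero {n : ℕ} (hn : 3 ≤ n) : ∃ l : n.Partition, l.crank = 0 := by
  refine ⟨⟨{n - 1, 1}, ?_, ?_⟩, ?_⟩
  · intro i hi
    simp only [Multiset.insert_eq_cons, Multiset.mem_cons, Multiset.mem_singleton] at hi
    omega
  · simp
    omega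
  · have h1 : 1 ≠ n - 1 := by omega
    have h2 : 1 < n - 1 := by omega
    simp [crank, numOnes, Multiset.count_cons_of_ne h1,
      Multiset.filter_cons_of_pos, Multiset.filter_singleton, h2]

end Nat.Partition

theorem coeff_rankPoly (n k : ℕ) :
    (rankPoly n).coeff k = if k < n then (rankCount k n : ℤ) else 0 :=
  coeff_sum_range_C_mul_X_pow (fun m => (rankCount m n : ℤ)) n k

theorem coeff_crankPoly (n k : ℕ) :
    (crankPoly n).coeff k = if k < n + 1 then (crankCount k n : ℤ) else 0 :=
  coeff_sum_range_C_mul_X_pow (fun m => (crankCount m n : ℤ)) (n + 1) k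

theorem coeff_rankPoly_nonneg (n k : ℕ) : 0 ≤ (rankPoly n).coeff k := by
  rw [coeff_rankPoly]
  positivity

theorem coeff_crankPoly_nonneg (n k : ℕ) : 0 ≤ (crankPoly n).coeff k := by
  rw [coeff_crankPoly]
  positivity

theorem monic_and_natDegree_rankPoly {n : ℕ} (hn : 1 ≤ n) :
    (rankPoly n).Monic ∧ (rankPoly n).natDegree = n - 1 := by
  have h : rankCount ((n - 1 : ℕ) : ℤ) n = 1 := by
    simp [rankCount, Nat.Partition.rank_eq_pred_iff (Nat.ne_of_gt hn),
      Finset.filter_eq']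
  have h' := monic_and_natDegree_sum_range_C_mul_X_pow
    (fun m => (rankCount (m : ℤ) n : ℤ)) (n - 1) (by simp only [h]; rfl)
  rwa [Nat.sub_add_cancel hn] at h'

theorem monic_and_natDegree_crankPoly {n : ℕ} (hn : 2 ≤ n) :
    (crankPoly n).Monic ∧ (crankPoly n).natDegree = n := by
  have h : crankCount (n : ℤ) n = 1 := by
    simp [crankCount, Nat.Partition.crank_eq_self_iff hn, Finset.filter_eq']
  exact monic_and_natDegree_sum_range_C_mul_X_pow
    (fun m => (crankCount (m : ℤ) n : ℤ)) n (by simp only [h]; rfl)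

theorem eval_one_rankPoly_le (n : ℕ) : (rankPoly n).eval 1 ≤ (partitionNumber n : ℤ) := by
  simp only [rankPoly, eval_finsetSum, eval_mul, eval_C, eval_pow, eval_X, one_pow, mul_one]
  exact_mod_cast sum_range_card_fiber_le (fun l : n.Partition => l.rank) n

theorem eval_one_crankPoly_le (n : ℕ) : (crankPoly n).eval 1 ≤ (partitionNumber n : ℤ) := by
  simp only [crankPoly, eval_finsetSum, eval_mul, eval_C, eval_pow, eval_X, one_pow, mul_one]
  exact_mod_cast sum_range_card_fiber_le (fun l : n.Partition => l.crank) (n + 1)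

theorem eval_zero_rankPoly_ne_zero {n : ℕ} (hn : 3 ≤ n) : (rankPoly n).eval 0 ≠ 0 := by
  rw [← coeff_zero_eq_eval_zero, coeff_rankPoly, if_pos (by omega)]
  obtain ⟨l, hl⟩ := Nat.Partition.exists_rank_eq_zero hn
  have : 0 < rankCount ((0 : ℕ) : ℤ) n := Finset.card_pos.2 ⟨l, by simp [hl]⟩
  exact_mod_cast this.ne'

theorem eval_zero_crankPoly_ne_zero {n : ℕ} (hn : 3 ≤ n) : (crankPoly n).eval 0 ≠ 0 := by
  rw [← coeff_zero_eq_eval_zero, coeff_crankPoly, if_pos (by omega)]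
  obtain ⟨l, hl⟩ := Nat.Partition.exists_crank_eq_zero hn
  have : 0 < crankCount ((0 : ℕ) : ℤ) n := Finset.card_pos.2 ⟨l, by simp [hl]⟩
  exact_mod_cast this.ne'

/-! ### Equidistribution of the arguments -/

theorem norm_eval_map_le_eval_one {q : ℤ[X]} (hq : ∀ k, 0 ≤ q.coeff k) {z : ℂ} (hz : ‖z‖ = 1) :
    ‖(q.map (Int.castRingHom ℂ)).eval z‖ ≤ (q.eval 1 : ℤ) := by
  rw [eval_map, eval₂_eq_sum_range, eval_eq_sum_range]
  refine (norm_sum_le _ _).trans_eq ?_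
  push_cast
  refine Finset.sum_congr rfl fun k _ => ?_
  rw [norm_mul, norm_pow, hz, one_pow, mul_one, mul_one, eq_intCast,
    Complex.norm_intCast, abs_of_nonneg (by exact_mod_cast hq k)]

theorem tendsto_integral_pow_zeroArgMeasure {q : ℕ → ℤ[X]} (hnonneg : ∀ n k, 0 ≤ (q n).coeff k)
    (hle : ∀ n, (q n).eval 1 ≤ (partitionNumber n : ℤ)) (hmonic : ∀ᶠ n in atTop, (q n).Monic)
    (hdeg : ∀ᶠ n in atTop, n ≤ (q n).natDegree + 1) (h0 : ∀ᶠ n in atTop, (q n).eval 0 ≠ 0)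
    (k : ℕ) :
    Tendsto (fun n => ∫ z : Circle, ((z ^ (k + 1) : Circle) : ℂ)
      ∂(zeroArgMeasure ((q n).map (Int.castRingHom ℂ)) : Measure Circle)) atTop (𝓝 0) := by
  rw [Metric.tendsto_nhds]
  intro δ hδ
  set c : ℝ := (k + 1) * 2 ^ (k + 1) with hc
  have hc0 : 0 < c := by positivity
  -- With A = δn/(8c) the power sum is at most 2cA = δn/4, and n ≤ 2 deg brings this below δ deg.
  have hε : 0 < δ / (8 * c) := by positivity
  filter_upwards [hmonic, hdeg, h0, eventually_partitionNumber_le_exp hε, eventually_ge_atTop 2]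
    with n hm hd h0 hp hn
  set P := (q n).map (Int.castRingHom ℂ) with hP
  have hPdeg : P.natDegree = (q n).natDegree := hm.natDegree_map _
  have hn0 : (0 : ℝ) < n := by exact_mod_cast (by omega : 0 < n)
  have hA : 0 < δ / (8 * c) * n := by positivity
  have hP0 : 1 ≤ ‖P.eval 0‖ := by
    rw [hP, eval_map, eval₂_at_zero, coeff_zero_eq_eval_zero, eq_intCast, Complex.norm_intCast]
    exact_mod_cast Int.one_le_abs h0
  have hM : ∀ z : ℂ, ‖z‖ = 1 → ‖P.eval z‖ ≤ Real.exp (δ / (8 * c) * n) := by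
    intro z hz
    refine (norm_eval_map_le_eval_one (hnonneg n) hz).trans (le_trans ?_ hp)
    exact_mod_cast hle n
  have hbound := norm_sum_argPoint_pow_le (hm.map _) hP0 hA hM k
  have hint : ∫ z : Circle, ((z ^ (k + 1) : Circle) : ℂ) ∂(zeroArgMeasure P : Measure Circle) =
      (P.natDegree : ℂ)⁻¹ * (P.roots.map fun w => (argPoint w : ℂ) ^ (k + 1)).sum := by
    simp only [Circle.coe_pow]
    exact integral_zeroArgMeasure P ⟨fun z : Circle => (z : ℂ) ^ (k + 1), by fun_prop⟩
  rw [dist_zero_right, hint, norm_mul, norm_inv, Complex.norm_natCast, hPdeg]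
  have hN : (n : ℝ) ≤ 2 * ((q n).natDegree : ℝ) := by
    exact_mod_cast (by omega : n ≤ 2 * (q n).natDegree)
  have hN0 : (0 : ℝ) < (q n).natDegree := by linarith
  rw [inv_mul_lt_iff₀ hN0]
  refine hbound.trans_lt ?_
  have : (k + 1 : ℝ) * (2 * (δ / (8 * c) * n)) * 2 ^ (k + 1) = δ * n / 4 := by
    rw [hc]
    field_simp
    ring
  rw [this]
  nlinarith

/-- A qualitative Erdős–Turán theorem for polynomials with non-negative integer coefficients whose
sum is bounded by the partition numbers. -/
theorem zeroArgsUniformlyDistributed_of_eval_one_le {q : ℕ → ℤ[X]}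
    (hnonneg : ∀ n k, 0 ≤ (q n).coeff k) (hle : ∀ n, (q n).eval 1 ≤ (partitionNumber n : ℤ))
    (hmonic : ∀ᶠ n in atTop, (q n).Monic) (hdeg : ∀ᶠ n in atTop, n ≤ (q n).natDegree + 1)
    (h0 : ∀ᶠ n in atTop, (q n).eval 0 ≠ 0) :
    ZeroArgsUniformlyDistributed fun n => (q n).map (Int.castRingHom ℂ) := by
  have hdeg' : ∀ n, ((q n).map (Int.castRingHom ℂ)).natDegree = (q n).natDegree := fun n =>
    natDegree_map_eq_of_injective Int.cast_injective _
  constructor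
  · rw [tendsto_atTop]
    intro b
    filter_upwards [hdeg, eventually_ge_atTop (b + 1)] with n hn hb
    rw [hdeg']
    omega
  · have hmass : ∀ P : ℂ[X], (zeroArgMeasure P).mass ≤ 1 := fun P => by
      rw [zeroArgMeasure_mass]
      exact inv_mul_le_one
    refine tendsto_finiteMeasure_circle_of_zpow (fun n => hmass _) circleLebesgue_mass.le ?_
    -- Exponent 0 compares masses, which are eventually 1; negative exponents are conjugates of
    -- positive ones.
    rintro ((_ | k) | k)
    · have h1 : ∀ ν : FiniteMeasure Circle, ∫ z : Circle, ((z ^ (Int.ofNat 0) : Circle) : ℂ)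
          ∂(ν : Measure Circle) = ((ν.mass : ℝ) : ℂ) := by
        intro ν
        simp only [Int.ofNat_eq_natCast, Nat.cast_zero, zpow_zero, Circle.coe_one, integral_const,
          FiniteMeasure.measureReal_eq_coe_coeFn]
        rw [FiniteMeasure.mass, Complex.real_smul, mul_one]
      simp only [h1, circleLebesgue_mass]
      refine tendsto_const_nhds.congr' ?_
      filter_upwards [hdeg, eventually_ge_atTop 2] with n hn hn2
      rw [zeroArgMeasure_mass, hdeg', inv_mul_cancel₀]
      exact_mod_cast (by omega : (q n).natDegree ≠ 0)
    · rw [integral_zpow_circleLebesgue (by simp; omega)]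
      exact tendsto_integral_pow_zeroArgMeasure hnonneg hle hmonic hdeg h0 k
    · rw [integral_zpow_circleLebesgue (by simp)]
      have h := (tendsto_integral_pow_zeroArgMeasure hnonneg hle hmonic hdeg h0 k).star
      simp only [star_zero] at h
      refine h.congr fun n => ?_
      rw [← starRingEnd_apply, ← integral_conj]
      refine integral_congr_ae (Eventually.of_forall fun z => ?_)
      simp only [zpow_negSucc, Circle.coe_inv_eq_conj]

theorem mainTheorem4 :
    (∀ n : ℕ, 1 ≤ n →
      (∀ k : ℕ, 0 ≤ (rankPoly n).coeff k) ∧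
      (rankPoly n).Monic ∧ (rankPoly n).natDegree = n - 1 ∧
      (rankPoly n).eval 1 ≤ (partitionNumber n : ℤ)) ∧
    (∀ n : ℕ, 2 ≤ n →
      (∀ k : ℕ, 0 ≤ (crankPoly n).coeff k) ∧
      (crankPoly n).Monic ∧ (crankPoly n).natDegree = n ∧
      (crankPoly n).eval 1 ≤ (partitionNumber n : ℤ)) ∧
    (∀ n : ℕ, 3 ≤ n → (rankPoly n).eval 0 ≠ 0 ∧ (crankPoly n).eval 0 ≠ 0) ∧
    ZeroArgsUniformlyDistributed (fun n => (rankPoly n).map (Int.castRingHom ℂ)) ∧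
    ZeroArgsUniformlyDistributed (fun n => (crankPoly n).map (Int.castRingHom ℂ)) := by
  refine ⟨fun n hn => ?_, fun n hn => ?_, fun n hn => ?_, ?_, ?_⟩
  · exact ⟨coeff_rankPoly_nonneg n, (monic_and_natDegree_rankPoly hn).1,
      (monic_and_natDegree_rankPoly hn).2, eval_one_rankPoly_le n⟩
  · exact ⟨coeff_crankPoly_nonneg n, (monic_and_natDegree_crankPoly hn).1,
      (monic_and_natDegree_crankPoly hn).2, eval_one_crankPoly_le n⟩
  · exact ⟨eval_zero_rankPoly_ne_zero hn, eval_zero_crankPoly_ne_zero hn⟩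
  · refine zeroArgsUniformlyDistributed_of_eval_one_le coeff_rankPoly_nonneg eval_one_rankPoly_le
      ?_ ?_ ?_
    · filter_upwards [eventually_ge_atTop 1] with n hn using (monic_and_natDegree_rankPoly hn).1
    · filter_upwards [eventually_ge_atTop 1] with n hn
      rw [(monic_and_natDegree_rankPoly hn).2]
      omega
    · filter_upwards [eventually_ge_atTop 3] with n hn using eval_zero_rankPoly_ne_zero hn
  · refine zeroArgsUniformlyDistributed_of_eval_one_le coeff_crankPoly_nonneg
      eval_one_crankPoly_le ?_ ?_ ?_
    · filter_upwards [eventually_ge_atTop 2] with n hn using (monic_and_natDegree_crankPoly hn).1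
    · filter_upwards [eventually_ge_atTop 2] with n hn
      rw [(monic_and_natDegree_crankPoly hn).2]
      omega
    · filter_upwards [eventually_ge_atTop 3] with n hn using eval_zero_crankPoly_ne_zero hn
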